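/- Fix $m,n,r\ge 0$ and $\mathbf C\in\mathbb R^{n\times n}$, and let $\mathcal M^{(r)(\mathbf C)}=\{\mathbf X\in\mathbb R^{m\times n}:\operatorname{rank}\mathbf X=r,\ \mathbf X\mathbf C=\mathbf X\}$, with the Riemannian metric induced from the inner product $\langle\mathbf A,\mathbf B\rangle=\operatorname{tr}(\mathbf A^T\mathbf B)$ of $\mathbb R^{m\times n}$. The tangent space $T_{\mathbf X}\mathcal M^{(r)(\mathbf C)}$ is the set of velocities at $\mathbf X$ of smooth curves in $\mathcal M^{(r)(\mathbf C)}$ through $\mathbf X$, and the gradient at $\mathbf X$ of (the restriction to $\mathcal M^{(r)(\mathbf C)}$ of) a function $f$ is the element $G\in T_{\mathbf X}\mathcal M^{(r)(\mathbf C)}$ with $\langle G,\xi\rangle=\mathrm Df(\mathbf X)[\xi]$ for all $\xi\in T_{\mathbf X}\mathcal M^{(r)(\mathbf C)}$, where $\mathrm Df(\mathbf X)[\xi]$ is the derivative of $f$ along any smooth curve in $\mathcal M^{(r)(\mathbf C)}$ with velocity $\xi$ at $\mathbf X$. Let $\mathbf X\in\mathcal M^{(r)(\mathbf C)}$ have the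 singular value decomposition $\mathbf X=\mathbf U\mathbf\Sigma\mathbf V^T$, where $\mathbf U\in\mathbb R^{m\times r}$ and $\mathbf V\in\mathbb R^{n\times r}$ have orthonormal columns and $\mathbf\Sigma\in\mathbb R^{r\times r}$ is diagonal with positive diagonal entries. Let $\mathbf W$ be a matrix whose columns are an orthonormal basis of the null space of $(\mathbf C-\mathbf I)^T$, and put $\mathrm P_{\mathbf U}=\mathbf U\mathbf U^T$, $\mathrm P_{\mathbf V}=\mathbf V\mathbf V^T$, $\mathrm P_{\mathbf W}=\mathbf W\mathbf W^T$. For a linear operator $h$ on $\mathbb R^{m\times n}$ with adjoint $h^*$, let $f_h(\mathbf Y)=\|h(\mathbf Y)\|_F^2/2$. Then: 1. $T_{\mathbf X}\mathcal M^{(r)(\mathbf C)}$ is a linear subspace of $\mathbb R^{m\times n}$, and the orthogonal projection onto it is $$\mathrm P_{T_{\mathbf X}\mathcal M^{(r)(\mathbf C)}}(\mathbf Z)=\bigl(\mathrm P_{\mathbf U}\mathbf Z\mathrm P_{\mathbf V}+(\mathbf I_m-\mathrm P_{\mathbf U})\mathbf Z\mathrm P_{\mathbf V}+\mathrm P_{\mathbf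 U}\mathbf Z(\mathbf I_n-\mathrm P_{\mathbf V})\bigr)\mathrm P_{\mathbf W}.$$ 2. If $h$ is self-adjoint and idempotent, then the gradient of $f_h$ on $\mathcal M^{(r)(\mathbf C)}$ at $\mathbf X$ exists, is unique and equals $\mathrm P_{T_{\mathbf X}\mathcal M^{(r)(\mathbf C)}}(h(\mathbf X))$. 3. For an arbitrary linear operator $h$, the gradient of $f_h$ on $\mathcal M^{(r)(\mathbf C)}$ at $\mathbf X$ exists, is unique and equals $\mathrm P_{T_{\mathbf X}\mathcal M^{(r)(\mathbf C)}}(h^*h(\mathbf X))$. 4. For every linear operator $h$ the Euclidean gradient of $f_h$ at every $\mathbf Y\in\mathbb R^{m\times n}$ is $h^*h(\mathbf Y)$; it equals $h(\mathbf Y)$ for all $\mathbf Y$ if and only if $h$ is self-adjoint and idempotent. 5. For every $\Omega\subseteq\{1,\dots,m\}\times\{1,\dots,n\}$, the sampling operator $\mathrm P_\Omega$, which keeps the entries with index in $\Omega$ and sets the others to $0$, is self-adjoint and idempotent. -/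

import Mathlib

open Matrix
open scoped ContDiff

attribute [local instance] Matrix.frobeniusNormedAddCommGroup

/-- The Euclidean space of real `m × n` matrices: the Frobenius norm comes from the inner product
`⟪A, B⟫ = tr (Aᵀ B)`. -/
noncomputable instance matrixInnerProductSpace {m n : ℕ} :
    InnerProductSpace ℝ (Matrix (Fin m) (Fin n) ℝ) where
  __ := (Matrix.frobeniusNormedSpace : NormedSpace ℝ (Matrix (Fin m) (Fin n) ℝ))
  inner A B := (Aᵀ * B).trace
  norm_sq_eq_re_inner A := by
    rw [Matrix.frobenius_norm_def, ← Real.sqrt_eq_rpow, Real.sq_sqrt (by positivity),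
      Finset.sum_comm]
    simp [Matrix.trace, Matrix.mul_apply, pow_two]
  conj_inner_symm A B := by
    simp only [conj_trivial]
    rw [← Matrix.trace_transpose, Matrix.transpose_mul, Matrix.transpose_transpose]
  add_left A B D := by
    rw [Matrix.transpose_add, Matrix.add_mul, Matrix.trace_add]
  smul_left A B c := by
    simp [Matrix.transpose_smul, Matrix.smul_mul, Matrix.trace_smul]

section EmbeddedGeometry

variable {E : Type*} [NormedAddCommGroup E] [InnerProductSpace ℝ E]

/-- `γ` is, near time `0`, a smooth curve in `S`, with `γ 0 = x` and `γ' 0 = ξ`. -/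
def IsCurveThrough (S : Set E) (x ξ : E) (γ : ℝ → E) : Prop :=
  γ 0 = x ∧ HasDerivAt γ ξ 0 ∧
    ∃ ε > 0, ContDiffOn ℝ ∞ γ (Set.Ioo (-ε) ε) ∧ ∀ t ∈ Set.Ioo (-ε) ε, γ t ∈ S

/-- The tangent vectors at `x` of an embedded submanifold `S` of `E`: the velocities at `x` of the
smooth curves in `S` through `x`. -/
def tangentVectors (S : Set E) (x : E) : Set E :=
  {ξ | ∃ γ : ℝ → E, IsCurveThrough S x ξ γ}

/-- `G` is the gradient at `x` of the restriction of `f` to the submanifold `S`, with the metric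
induced from `E`: it is tangent, and `⟪G, ξ⟫ = D f(x)[ξ]` for every tangent vector `ξ`, where
`D f(x)[ξ]` is the derivative of `f` along any smooth curve in `S` with velocity `ξ` at `x`. -/
def IsRiemannianGradient (S : Set E) (f : E → ℝ) (x G : E) : Prop :=
  G ∈ tangentVectors S x ∧
    ∀ ξ ∈ tangentVectors S x, ∀ γ : ℝ → E, IsCurveThrough S x ξ γ →
      HasDerivAt (fun t => f (γ t)) (inner ℝ G ξ) 0

end EmbeddedGeometry

/-- The manifold of real `m × n` matrices of rank `r`. -/
def constantRank (m n r : ℕ) : Set (Matrix (Fin m) (Fin n) ℝ) :=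
  {X | X.rank = r}

/-- The matrices of rank `r` with the self-expressive property `X C = X`. -/
def selfExpressive (m : ℕ) {n : ℕ} (r : ℕ) (C : Matrix (Fin n) (Fin n) ℝ) :
    Set (Matrix (Fin m) (Fin n) ℝ) :=
  {X ∈ constantRank m n r | X * C = X}

/-- `X = U Σ Vᵀ` is a compact singular value decomposition, with singular values `σ`. -/
structure IsCompactSVD {m n r : ℕ} (X : Matrix (Fin m) (Fin n) ℝ) (U : Matrix (Fin m) (Fin r) ℝ)
    (σ : Fin r → ℝ) (V : Matrix (Fin n) (Fin r) ℝ) : Prop where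
  orthonormal_left : Uᵀ * U = 1
  orthonormal_right : Vᵀ * V = 1
  pos : ∀ i, 0 < σ i
  eq : X = U * Matrix.diagonal σ * Vᵀ

/-- The columns of `W` are an orthonormal basis of the null space of `A`. -/
structure IsOrthonormalNullBasis {l n k : ℕ} (A : Matrix (Fin l) (Fin n) ℝ)
    (W : Matrix (Fin n) (Fin k) ℝ) : Prop where
  orthonormal : Wᵀ * W = 1
  span_eq : Submodule.span ℝ (Set.range W.col) = LinearMap.ker A.mulVecLin

/-- The orthogonal projection `P_A = A Aᵀ` onto the column space of a matrix `A` with orthonormal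
columns. -/
def colProj {n k : ℕ} (A : Matrix (Fin n) (Fin k) ℝ) : Matrix (Fin n) (Fin n) ℝ :=
  A * Aᵀ

/-- `Z ↦ (P_U Z P_V + (I - P_U) Z P_V + P_U Z (I - P_V)) P_W`. -/
def tangentFormula {m n r k : ℕ} (U : Matrix (Fin m) (Fin r) ℝ) (V : Matrix (Fin n) (Fin r) ℝ)
    (W : Matrix (Fin n) (Fin k) ℝ) (Z : Matrix (Fin m) (Fin n) ℝ) : Matrix (Fin m) (Fin n) ℝ :=
  (colProj U * Z * colProj V + (1 - colProj U) * Z * colProj V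
    + colProj U * Z * (1 - colProj V)) * colProj W

/-- The objective `f(X) = ‖h(X)‖_F² / 2`. -/
noncomputable def objective {m n : ℕ}
    (h : Matrix (Fin m) (Fin n) ℝ →ₗ[ℝ] Matrix (Fin m) (Fin n) ℝ) (X : Matrix (Fin m) (Fin n) ℝ) :
    ℝ :=
  ‖h X‖ ^ 2 / 2

open scoped Classical in
/-- The sampling operator `P_Ω`, which keeps the entries in `Ω` and sets all others to `0`. -/
noncomputable def samplingOperator {m n : ℕ} (Ω : Set (Fin m × Fin n)) :
    Matrix (Fin m) (Fin n) ℝ →ₗ[ℝ] Matrix (Fin m) (Fin n) ℝ where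
  toFun X := Matrix.of fun i j => if (i, j) ∈ Ω then X i j else 0
  map_add' X Y := by ext i j; by_cases hij : (i, j) ∈ Ω <;> simp [hij]
  map_smul' c X := by ext i j; by_cases hij : (i, j) ∈ Ω <;> simp [hij]

/-! If `Y` has rank `r` and `Uᵀ Y V` is invertible, then `Y = Y V (Uᵀ Y V)⁻¹ Uᵀ Y`
(`eq_mul_inv_mul_of_rank_eq`). So along a curve through `X` the block `(1 - P_U) Y (1 - P_V)` is a
product with two factors vanishing at `X`, and its velocity is zero. Conversely, a `ξ` with `ξ C =
ξ` and zero normal block is the velocity of an explicit quadratic curve with a rank-`r`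
factorization. This identifies the tangent space as `selfExpressiveTangent`.

On it `ξ C = ξ` means `ξ P_W = ξ`, and `P_V P_W = P_V`, so the formula collapses to `P_U Z P_W + (1
- P_U) Z P_V`, a self-adjoint map into the tangent space that fixes it. Riemannian gradients are
projections of the Euclidean gradient `h* h`. -/

section EuclideanGradient

variable {E : Type*} [NormedAddCommGroup E] [InnerProductSpace ℝ E] [FiniteDimensional ℝ E]

theorem hasGradientAt_half_norm_sq_comp [CompleteSpace E] (h : E →ₗ[ℝ] E) (y : E) :
    HasGradientAt (fun z => ‖h z‖ ^ 2 / 2) (LinearMap.adjoint h (h y)) y := by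
  rw [hasGradientAt_iff_hasFDerivAt]
  have h1 := ((LinearMap.toContinuousLinearMap h).hasFDerivAt (x := y)).norm_sq.mul_const (2⁻¹ : ℝ)
  simp only [LinearMap.coe_toContinuousLinearMap', ← div_eq_mul_inv] at h1
  refine h1.congr_fderiv ?_
  ext v
  simp [LinearMap.adjoint_inner_left]

/-- If `h* h = h`, both `⟪h x, y⟫` and `⟪x, h y⟫` equal `⟪h x, h y⟫`; symmetry then turns `h* h = h`
into `h h = h`. -/
theorem isSymmetric_and_isIdempotentElem_iff (h : E →ₗ[ℝ] E) :
    (h.IsSymmetric ∧ IsIdempotentElem h) ↔ ∀ y, LinearMap.adjoint h (h y) = h y := by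
  constructor
  · rintro ⟨hs, hi⟩ y
    rw [LinearMap.isSymmetric_iff_isSelfAdjoint, isSelfAdjoint_iff, LinearMap.star_eq_adjoint] at hs
    rw [hs]
    exact LinearMap.congr_fun hi y
  · intro H
    have hs : h.IsSymmetric := fun x y => by
      have h1 := LinearMap.adjoint_inner_left h y (h x)
      have h2 := LinearMap.adjoint_inner_right h x (h y)
      rw [H] at h1 h2
      rw [h1, h2]
    have hs' := hs
    rw [LinearMap.isSymmetric_iff_isSelfAdjoint, isSelfAdjoint_iff,
      LinearMap.star_eq_adjoint] at hs'
    rw [hs'] at H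
    exact ⟨hs, LinearMap.ext H⟩

/-- By the chain rule only the pairing of `g` with `T` matters, and the projection is the one
element of `T` with the same pairing. -/
theorem isRiemannianGradient_iff_eq_starProjection [CompleteSpace E] {S : Set E} {x g : E}
    {f : E → ℝ} {T : Submodule ℝ E} (hT : (T : Set E) = tangentVectors S x)
    (hf : HasGradientAt f g x) (G : E) :
    IsRiemannianGradient S f x G ↔ G = T.starProjection g := by
  have hderiv : ∀ ξ : E, ∀ γ : ℝ → E, IsCurveThrough S x ξ γ →
      HasDerivAt (fun t => f (γ t)) (inner ℝ g ξ) 0 := by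
    rintro ξ γ ⟨h0, hd, -⟩
    have hf' : HasFDerivAt f (InnerProductSpace.toDual ℝ E g) (γ 0) := by
      rw [h0]; exact hf.hasFDerivAt
    have h1 := hf'.comp_hasDerivAt (0 : ℝ) hd
    rw [InnerProductSpace.toDual_apply_apply] at h1
    exact h1
  have horth : ∀ ξ ∈ T, inner ℝ (T.starProjection g) ξ = inner ℝ g ξ := fun ξ hξ => by
    rw [Submodule.inner_starProjection_left_eq_right, Submodule.starProjection_eq_self_iff.2 hξ]
  constructor
  · rintro ⟨hG, H⟩
    rw [← hT] at hG
    refine (Submodule.eq_starProjection_of_mem_of_inner_eq_zero hG fun ξ hξ => ?_).symm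
    obtain ⟨γ, hγ⟩ : ξ ∈ tangentVectors S x := hT ▸ hξ
    rw [inner_sub_left, (hderiv ξ γ hγ).unique (H ξ ⟨γ, hγ⟩ γ hγ), sub_self]
  · rintro rfl
    refine ⟨hT ▸ Submodule.starProjection_apply_mem T g, fun ξ hξ γ hγ => ?_⟩
    rw [horth ξ (by rw [← hT] at hξ; exact hξ)]
    exact hderiv ξ γ hγ

end EuclideanGradient

theorem samplingOperator_isSymmetric {m n : ℕ} (Ω : Set (Fin m × Fin n)) :
    (samplingOperator Ω).IsSymmetric := by
  intro A B
  change ((samplingOperator Ω A)ᵀ * B).trace = (Aᵀ * samplingOperator Ω B).trace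
  simp only [Matrix.trace, Matrix.diag, Matrix.mul_apply, Matrix.transpose_apply]
  refine Finset.sum_congr rfl fun j _ => Finset.sum_congr rfl fun i _ => ?_
  by_cases hij : (i, j) ∈ Ω <;> simp [samplingOperator, hij]

theorem samplingOperator_isIdempotentElem {m n : ℕ} (Ω : Set (Fin m × Fin n)) :
    IsIdempotentElem (samplingOperator Ω) := by
  refine LinearMap.ext fun A => ?_
  ext i j
  by_cases hij : (i, j) ∈ Ω <;> simp [samplingOperator, hij]

/-! ### Rank compression and matrix curves -/

/-- A matrix of rank `r` is recovered from an invertible `r × r` compression of it. -/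
theorem eq_mul_inv_mul_of_rank_eq {m n r : ℕ} {A : Matrix (Fin m) (Fin n) ℝ} (hA : A.rank = r)
    (P : Matrix (Fin r) (Fin m) ℝ) (Q : Matrix (Fin n) (Fin r) ℝ)
    (hdet : (P * A * Q).det ≠ 0) :
    A = A * Q * (P * A * Q)⁻¹ * (P * A) := by
  have hunit : IsUnit (P * A * Q).det := isUnit_iff_ne_zero.2 hdet
  have hrank : r ≤ (A * Q).rank := by
    have h1 := Matrix.rank_of_isUnit _ ((Matrix.isUnit_iff_isUnit_det _).2 hunit)
    rw [Fintype.card_fin] at h1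
    rw [Matrix.mul_assoc] at h1
    exact h1.symm.le.trans (Matrix.rank_mul_le_right _ _)
  -- `A * Q` already has rank `r`, so its column space is that of `A`, and `A = A * Q * K` for some
  -- `K`.
  have hle : LinearMap.range (A * Q).mulVecLin ≤ LinearMap.range A.mulVecLin := by
    rw [Matrix.mulVecLin_mul]
    exact LinearMap.range_comp_le_range _ _
  have heq := Submodule.eq_of_le_of_finrank_le hle (by
    change A.rank ≤ (A * Q).rank
    rw [hA]; exact hrank)
  have hcol : ∀ j, ∃ v, (A * Q).mulVecLin v = A.mulVecLin (Pi.single j 1) := fun j => by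
    have : A.mulVecLin (Pi.single j 1) ∈ LinearMap.range (A * Q).mulVecLin := by
      rw [heq]; exact LinearMap.mem_range_self _ _
    exact this
  choose v hv using hcol
  have hK : A * Q * (Matrix.of v)ᵀ = A := by
    ext i j
    have := congrFun (hv j) i
    simp only [Matrix.mulVecLin_apply, Matrix.mulVec_single_one, Matrix.col_apply] at this
    rw [← this]
    rfl
  -- Multiplying `A = A * Q * K` by `P` determines `K`.
  have hPA : P * A = P * A * Q * (Matrix.of v)ᵀ := by
    conv_lhs => rw [← hK]
    simp only [Matrix.mul_assoc]
  have hKinv : (P * A * Q)⁻¹ * (P * A) = (Matrix.of v)ᵀ := by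
    nth_rewrite 2 [hPA]
    exact Matrix.nonsing_inv_mul_cancel_left _ _ hunit
  rw [Matrix.mul_assoc (A * Q), hKinv, hK]

theorem hasDerivAt_linearMap_comp {E F : Type*} [NormedAddCommGroup E] [NormedSpace ℝ E]
    [FiniteDimensional ℝ E] [NormedAddCommGroup F] [NormedSpace ℝ F] (L : E →ₗ[ℝ] F)
    {γ : ℝ → E} {ξ : E} {t : ℝ} (hγ : HasDerivAt γ ξ t) :
    HasDerivAt (fun s => L (γ s)) (L ξ) t :=
  (LinearMap.toContinuousLinearMap L).hasFDerivAt.comp_hasDerivAt t hγ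

/-- Multiplication on both sides by fixed matrices. -/
def Matrix.mulLeftRight {a b c d : ℕ} (P : Matrix (Fin a) (Fin b) ℝ)
    (Q : Matrix (Fin c) (Fin d) ℝ) :
    Matrix (Fin b) (Fin c) ℝ →ₗ[ℝ] Matrix (Fin a) (Fin d) ℝ where
  toFun A := P * A * Q
  map_add' A B := by rw [Matrix.mul_add, Matrix.add_mul]
  map_smul' s A := by simp

theorem HasDerivAt.matrix_mul_mul {a b c d : ℕ} (P : Matrix (Fin a) (Fin b) ℝ)
    (Q : Matrix (Fin c) (Fin d) ℝ) {γ : ℝ → Matrix (Fin b) (Fin c) ℝ}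
    {ξ : Matrix (Fin b) (Fin c) ℝ} {t : ℝ} (hγ : HasDerivAt γ ξ t) :
    HasDerivAt (fun s => P * γ s * Q) (P * ξ * Q) t :=
  hasDerivAt_linearMap_comp (Matrix.mulLeftRight P Q) hγ

/-- If two matrix curves vanish at `0`, then so does the derivative of their product with a
continuous curve in between. -/
theorem hasDerivAt_mul_mul_of_eq_zero {a b c d : ℕ} {A : ℝ → Matrix (Fin a) (Fin b) ℝ}
    {K : ℝ → Matrix (Fin b) (Fin c) ℝ} {B : ℝ → Matrix (Fin c) (Fin d) ℝ}
    {A' : Matrix (Fin a) (Fin b) ℝ} {B' : Matrix (Fin c) (Fin d) ℝ}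
    (hA : HasDerivAt A A' 0) (hB : HasDerivAt B B' 0) (hK : ContinuousAt K 0)
    (hA0 : A 0 = 0) (hB0 : B 0 = 0) :
    HasDerivAt (fun t => A t * K t * B t) 0 0 := by
  -- The factors are `O(t)`, `O(1)` and `o(1)`, so the product is `o(t)`.
  have hAO : A =O[nhds 0] fun t : ℝ => t := by simpa [hA0] using hA.isBigO_sub
  have hBo : B =o[nhds 0] fun _ : ℝ => (1 : ℝ) := by
    rw [Asymptotics.isLittleO_one_iff]
    simpa [ContinuousAt, hB0] using hB.continuousAt
  have hKO : K =O[nhds 0] fun _ : ℝ => (1 : ℝ) := hK.isBigO_one ℝ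
  refine hasDerivAt_iff_isLittleO.2 ?_
  have hprod := ((hAO.norm_left.mul hKO.norm_left).mul_isLittleO hBo.norm_left)
  simp only [mul_one] at hprod
  simp only [hA0, Matrix.zero_mul, sub_zero, smul_zero]
  refine Asymptotics.IsBigO.trans_isLittleO (Asymptotics.IsBigO.of_bound 1 ?_) hprod
  refine Filter.Eventually.of_forall fun t => ?_
  rw [one_mul, Real.norm_of_nonneg (by positivity)]
  exact (Matrix.frobenius_norm_mul _ _).trans
    (mul_le_mul_of_nonneg_right (Matrix.frobenius_norm_mul _ _) (norm_nonneg _))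

/-- A quadratic curve that stays in `S` near time `0` has a tangent velocity. -/
theorem mem_tangentVectors_of_quadratic {E : Type*} [NormedAddCommGroup E]
    [InnerProductSpace ℝ E] {S : Set E} {x ξ q : E}
    (h : ∀ᶠ t : ℝ in nhds 0, x + t • ξ + t ^ 2 • q ∈ S) : ξ ∈ tangentVectors S x := by
  refine ⟨fun t => x + t • ξ + t ^ 2 • q, by simp, ?_, ?_⟩
  · have h1 := (((hasDerivAt_id (0 : ℝ)).smul_const ξ).const_add x).add
      ((hasDerivAt_pow 2 (0 : ℝ)).smul_const q)
    simpa [Pi.add_def] using h1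
  · obtain ⟨ε, hε, hball⟩ := Metric.eventually_nhds_iff_ball.1 h
    refine ⟨ε, hε, ContDiff.contDiffOn (by fun_prop), fun t ht => hball t ?_⟩
    rw [Real.ball_eq_Ioo]
    simpa using ht

theorem IsCurveThrough.eventually_mem {E : Type*} [NormedAddCommGroup E] [InnerProductSpace ℝ E]
    {S : Set E} {x ξ : E} {γ : ℝ → E} (h : IsCurveThrough S x ξ γ) :
    ∀ᶠ t in nhds (0 : ℝ), γ t ∈ S := by
  obtain ⟨-, -, ε, hε, -, hS⟩ := h
  filter_upwards [Ioo_mem_nhds (neg_lt_zero.2 hε) hε] using hS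

/-- The matrices `ξ` with `ξ C = ξ` that have no component normal to both `U` and `V`. -/
def selfExpressiveTangent {m n r : ℕ} (C : Matrix (Fin n) (Fin n) ℝ)
    (U : Matrix (Fin m) (Fin r) ℝ) (V : Matrix (Fin n) (Fin r) ℝ) :
    Submodule ℝ (Matrix (Fin m) (Fin n) ℝ) where
  carrier := {ξ | ξ * C = ξ ∧ (1 - colProj U) * ξ * (1 - colProj V) = 0}
  add_mem' := by
    rintro a b ⟨ha, ha'⟩ ⟨hb, hb'⟩
    exact ⟨by rw [Matrix.add_mul, ha, hb], by
      rw [Matrix.mul_add, Matrix.add_mul, ha', hb', add_zero]⟩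
  zero_mem' := by simp
  smul_mem' := by
    rintro c a ⟨ha, ha'⟩
    exact ⟨by rw [Matrix.smul_mul, ha], by rw [Matrix.mul_smul, Matrix.smul_mul, ha', smul_zero]⟩

theorem inner_mul_mul_left {a b c d : ℕ} (P : Matrix (Fin a) (Fin b) ℝ)
    (Z : Matrix (Fin b) (Fin c) ℝ) (Q : Matrix (Fin c) (Fin d) ℝ)
    (A : Matrix (Fin a) (Fin d) ℝ) :
    inner ℝ (P * Z * Q) A = inner ℝ Z (Pᵀ * A * Qᵀ) := by
  change ((P * Z * Q)ᵀ * A).trace = (Zᵀ * (Pᵀ * A * Qᵀ)).trace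
  rw [Matrix.transpose_mul, Matrix.transpose_mul, Matrix.mul_assoc, Matrix.trace_mul_comm]
  simp only [Matrix.mul_assoc]

/-! ### The tangent space at `X` -/

section SVD

variable {m n r k : ℕ} {C : Matrix (Fin n) (Fin n) ℝ} {X : Matrix (Fin m) (Fin n) ℝ}
  {U : Matrix (Fin m) (Fin r) ℝ} {σ : Fin r → ℝ} {V : Matrix (Fin n) (Fin r) ℝ}
  {W : Matrix (Fin n) (Fin k) ℝ}

theorem IsCompactSVD.det_diagonal_ne_zero (h : IsCompactSVD X U σ V) :
    (Matrix.diagonal σ).det ≠ 0 := by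
  rw [Matrix.det_diagonal]
  exact Finset.prod_ne_zero_iff.2 fun i _ => (h.pos i).ne'

theorem IsCompactSVD.transpose_mul_mul (h : IsCompactSVD X U σ V) :
    Uᵀ * X * V = Matrix.diagonal σ := by
  rw [h.eq, ← Matrix.mul_assoc, ← Matrix.mul_assoc, h.orthonormal_left, Matrix.one_mul,
    Matrix.mul_assoc, h.orthonormal_right, Matrix.mul_one]

theorem IsCompactSVD.one_sub_colProj_mul (h : IsCompactSVD X U σ V) :
    (1 - colProj U) * U = 0 := by
  rw [Matrix.sub_mul, colProj, Matrix.mul_assoc, h.orthonormal_left, Matrix.one_mul,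
    Matrix.mul_one, sub_self]

theorem IsCompactSVD.transpose_mul_one_sub_colProj_left (h : IsCompactSVD X U σ V) :
    Uᵀ * (1 - colProj U) = 0 := by
  rw [Matrix.mul_sub, colProj, ← Matrix.mul_assoc, h.orthonormal_left, Matrix.one_mul,
    Matrix.mul_one, sub_self]

theorem IsCompactSVD.transpose_mul_one_sub_colProj (h : IsCompactSVD X U σ V) :
    Vᵀ * (1 - colProj V) = 0 := by
  rw [Matrix.mul_sub, colProj, ← Matrix.mul_assoc, h.orthonormal_right, Matrix.one_mul,
    Matrix.mul_one, sub_self]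

theorem IsCompactSVD.transpose_mul_eq (h : IsCompactSVD X U σ V) (hXC : X * C = X) :
    Vᵀ * C = Vᵀ := by
  have h1 : Matrix.diagonal σ * (Vᵀ * C) = Matrix.diagonal σ * Vᵀ := by
    have h2 : Uᵀ * X = Matrix.diagonal σ * Vᵀ := by
      rw [h.eq, ← Matrix.mul_assoc, ← Matrix.mul_assoc, h.orthonormal_left, Matrix.one_mul]
    rw [← Matrix.mul_assoc, ← h2, Matrix.mul_assoc, hXC]
  have hu := isUnit_iff_ne_zero.2 h.det_diagonal_ne_zero
  rw [← Matrix.nonsing_inv_mul_cancel_left (Matrix.diagonal σ) (Vᵀ * C) hu, h1,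
    Matrix.nonsing_inv_mul_cancel_left (Matrix.diagonal σ) _ hu]

theorem tangentVectors_subset_selfExpressiveTangent (h : IsCompactSVD X U σ V) :
    tangentVectors (selfExpressive m r C) X ⊆ selfExpressiveTangent C U V := by
  rintro ξ ⟨γ, hγ⟩
  have hmem := hγ.eventually_mem
  obtain ⟨h0, hd, -⟩ := hγ
  have hd' : HasDerivAt γ ξ 0 := hd
  have hd1 : ∀ {a b : ℕ} (P : Matrix (Fin a) (Fin m) ℝ) (Q : Matrix (Fin n) (Fin b) ℝ),
    HasDerivAt (fun s => P * γ s * Q) (P * ξ * Q) 0 := fun P Q => hd'.matrix_mul_mul P Q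
  constructor
  · have h1 := hd1 (1 : Matrix (Fin m) (Fin m) ℝ) C
    simp only [Matrix.one_mul] at h1
    refine h1.unique (hd'.congr_of_eventuallyEq ?_)
    filter_upwards [hmem] with t ht using ht.2
  · have hM0 : (Uᵀ * γ 0 * V).det ≠ 0 := by
      rw [h0, h.transpose_mul_mul]; exact h.det_diagonal_ne_zero
    have hM : ContinuousAt (fun t => Uᵀ * γ t * V) 0 := (hd1 Uᵀ V).continuousAt
    have hdet : ContinuousAt (fun t => (Uᵀ * γ t * V).det) 0 :=
      (continuous_id.matrix_det).continuousAt.comp hM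
    have hinv : ContinuousAt (fun t => (Uᵀ * γ t * V)⁻¹) 0 := by
      simp only [Matrix.inv_def, Ring.inverse_eq_inv']
      exact (hdet.inv₀ hM0).smul ((continuous_id.matrix_adjugate).continuousAt.comp hM)
    -- The outer factors vanish at `0` because `(1 - P_U) U = 0` and `Vᵀ (1 - P_V) = 0`.
    have hzero : HasDerivAt (fun t => ((1 - colProj U) * γ t * V) * (Uᵀ * γ t * V)⁻¹ *
        (Uᵀ * γ t * (1 - colProj V))) 0 0 := by
      refine hasDerivAt_mul_mul_of_eq_zero (hd1 _ _) (hd1 _ _) hinv ?_ ?_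
      · rw [h0, h.eq, ← Matrix.mul_assoc, ← Matrix.mul_assoc, h.one_sub_colProj_mul]
        simp only [Matrix.zero_mul]
      · rw [h0, h.eq, Matrix.mul_assoc, Matrix.mul_assoc _ Vᵀ,
          h.transpose_mul_one_sub_colProj]
        simp only [Matrix.mul_zero]
    refine (hd1 _ _).unique (hzero.congr_of_eventuallyEq ?_)
    filter_upwards [hmem, hdet.eventually_ne hM0] with t ht hdt
    have := eq_mul_inv_mul_of_rank_eq ht.1 Uᵀ V hdt
    calc (1 - colProj U) * γ t * (1 - colProj V)
        = (1 - colProj U) * (γ t * V * (Uᵀ * γ t * V)⁻¹ * (Uᵀ * γ t)) * (1 - colProj V) := by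
          rw [← this]
      _ = _ := by simp only [Matrix.mul_assoc]

theorem selfExpressiveTangent_subset_tangentVectors (h : IsCompactSVD X U σ V)
    (hXC : X * C = X) :
    (selfExpressiveTangent C U V : Set (Matrix (Fin m) (Fin n) ℝ)) ⊆
      tangentVectors (selfExpressive m r C) X := by
  rintro ξ ⟨hξC, hξ⟩
  have hu := isUnit_iff_ne_zero.2 h.det_diagonal_ne_zero
  -- `D` is the motion of the column factor: `D Σ Vᵀ` is the part of `ξ` normal to `U`, while `Uᵀ ξ`
  -- moves the row factor.
  set D := (1 - colProj U) * ξ * V * (Matrix.diagonal σ)⁻¹ with hD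
  have hDσ : D * Matrix.diagonal σ = (1 - colProj U) * ξ * V :=
    Matrix.nonsing_inv_mul_cancel_right _ _ hu
  have hUD : Uᵀ * D = 0 := by
    rw [hD]
    simp only [← Matrix.mul_assoc, h.transpose_mul_one_sub_colProj_left, Matrix.zero_mul]
  have hsplit : U * (Uᵀ * ξ) + D * Matrix.diagonal σ * Vᵀ = ξ := by
    rw [hDσ]
    have h1 : (1 - colProj U) * ξ * V * Vᵀ = (1 - colProj U) * ξ := by
      rw [Matrix.mul_sub, Matrix.mul_one, sub_eq_zero] at hξ
      rw [Matrix.mul_assoc _ V]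
      exact hξ.symm
    rw [h1, Matrix.sub_mul, Matrix.one_mul, colProj, Matrix.mul_assoc]
    abel
  have hfactor : ∀ t : ℝ, X + t • ξ + t ^ 2 • (D * (Uᵀ * ξ)) =
      (U + t • D) * (Matrix.diagonal σ * Vᵀ + t • (Uᵀ * ξ)) := by
    intro t
    trans U * Matrix.diagonal σ * Vᵀ + t • (U * (Uᵀ * ξ) + D * Matrix.diagonal σ * Vᵀ) +
      t ^ 2 • (D * (Uᵀ * ξ))
    · rw [← h.eq, hsplit]
    · simp only [Matrix.add_mul, Matrix.mul_add, Matrix.smul_mul, Matrix.mul_smul, smul_add,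
        smul_smul, pow_two, Matrix.mul_assoc]
      abel
  refine mem_tangentVectors_of_quadratic (q := D * (Uᵀ * ξ)) ?_
  -- Since `Uᵀ D = 0`, the quadratic term drops out; invertibility near `0` gives rank at least `r`,
  -- and the factorization gives at most `r`.
  have hcomp : ∀ t : ℝ, Uᵀ * (X + t • ξ + t ^ 2 • (D * (Uᵀ * ξ))) * V =
      Matrix.diagonal σ + t • (Uᵀ * ξ * V) := by
    intro t
    rw [Matrix.mul_add, Matrix.mul_add, Matrix.mul_smul, Matrix.mul_smul, ← Matrix.mul_assoc Uᵀ D,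
      hUD, Matrix.zero_mul, smul_zero, add_zero, Matrix.add_mul, h.transpose_mul_mul,
      Matrix.smul_mul]
  have hdet : ContinuousAt (fun t : ℝ => (Matrix.diagonal σ + t • (Uᵀ * ξ * V)).det) 0 := by
    have : Continuous fun t : ℝ => Matrix.diagonal σ + t • (Uᵀ * ξ * V) := by fun_prop
    exact this.matrix_det.continuousAt
  have hne := hdet.eventually_ne (y := 0) (by simpa using h.det_diagonal_ne_zero)
  filter_upwards [hne] with t ht
  refine ⟨le_antisymm ?_ ?_, ?_⟩
  · rw [hfactor]
    exact (Matrix.rank_mul_le_left _ _).trans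
      ((Matrix.rank_le_width _))
  · rw [← hcomp] at ht
    have h1 := Matrix.rank_of_isUnit _
      ((Matrix.isUnit_iff_isUnit_det _).2 (isUnit_iff_ne_zero.2 ht))
    rw [Fintype.card_fin] at h1
    exact h1.symm.le.trans ((Matrix.rank_mul_le_left _ _).trans (Matrix.rank_mul_le_right _ _))
  · simp only [Matrix.add_mul, Matrix.smul_mul, hXC, hξC, Matrix.mul_assoc]

theorem coe_selfExpressiveTangent (h : IsCompactSVD X U σ V) (hXC : X * C = X) :
    (selfExpressiveTangent C U V : Set (Matrix (Fin m) (Fin n) ℝ)) =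
      tangentVectors (selfExpressive m r C) X :=
  (selfExpressiveTangent_subset_tangentVectors h hXC).antisymm
    (tangentVectors_subset_selfExpressiveTangent h)

/-! ### The orthogonal projection -/

theorem colProj_transpose {a b : ℕ} (A : Matrix (Fin a) (Fin b) ℝ) :
    (colProj A)ᵀ = colProj A := by
  rw [colProj, Matrix.transpose_mul, Matrix.transpose_transpose]

theorem colProj_mul_colProj {a b : ℕ} {A : Matrix (Fin a) (Fin b) ℝ} (hA : Aᵀ * A = 1) :
    colProj A * colProj A = colProj A := by
  rw [colProj, Matrix.mul_assoc, ← Matrix.mul_assoc Aᵀ, hA, Matrix.one_mul]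

theorem IsOrthonormalNullBasis.colProj_mulVec_eq_iff {l : ℕ} {A : Matrix (Fin l) (Fin n) ℝ}
    (hW : IsOrthonormalNullBasis A W) (x : Fin n → ℝ) :
    colProj W *ᵥ x = x ↔ A *ᵥ x = 0 := by
  have hmem : A *ᵥ x = 0 ↔ ∃ y, W *ᵥ y = x := by
    change x ∈ LinearMap.ker A.mulVecLin ↔ x ∈ LinearMap.range W.mulVecLin
    rw [← hW.span_eq, Matrix.range_mulVecLin]
  rw [hmem]
  constructor
  · intro hx
    exact ⟨Wᵀ *ᵥ x, by rw [Matrix.mulVec_mulVec]; exact hx⟩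
  · rintro ⟨y, rfl⟩
    rw [Matrix.mulVec_mulVec, colProj, Matrix.mul_assoc, hW.orthonormal, Matrix.mul_one]

/-- Row by row: both sides say that each row of `A`, as a column vector, is fixed by `Cᵀ`. -/
theorem IsOrthonormalNullBasis.mul_colProj_eq_iff (hW : IsOrthonormalNullBasis (C - 1)ᵀ W)
    {a : ℕ} (A : Matrix (Fin a) (Fin n) ℝ) : A * colProj W = A ↔ A * C = A := by
  have key : ∀ B : Matrix (Fin n) (Fin n) ℝ, A * B = A ↔ ∀ i, Bᵀ *ᵥ A i = A i := by
    intro B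
    simp only [Matrix.mulVec_transpose]
    exact funext_iff
  rw [key, key, colProj_transpose]
  refine forall_congr' fun i => ?_
  rw [hW.colProj_mulVec_eq_iff, Matrix.transpose_sub, Matrix.transpose_one, Matrix.sub_mulVec,
    Matrix.one_mulVec, sub_eq_zero]

theorem starProjection_selfExpressiveTangent (h : IsCompactSVD X U σ V) (hXC : X * C = X)
    (hW : IsOrthonormalNullBasis (C - 1)ᵀ W) (Z : Matrix (Fin m) (Fin n) ℝ) :
    (selfExpressiveTangent C U V).starProjection Z = tangentFormula U V W Z := by
  have hVW : Vᵀ * colProj W = Vᵀ := (hW.mul_colProj_eq_iff _).2 (h.transpose_mul_eq hXC)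
  have hVW' : colProj V * colProj W = colProj V := by
    rw [colProj, Matrix.mul_assoc, hVW]
  have hU := colProj_mul_colProj h.orthonormal_left
  have hV := colProj_mul_colProj h.orthonormal_right
  have hWW := colProj_mul_colProj hW.orthonormal
  have hform : tangentFormula U V W Z =
      colProj U * Z * colProj W + (1 - colProj U) * Z * colProj V := by
    rw [tangentFormula]
    simp only [Matrix.add_mul, Matrix.sub_mul, Matrix.mul_sub, Matrix.mul_one, Matrix.one_mul,
      Matrix.mul_assoc, hVW']
    abel
  have hUc : (1 - colProj U) * colProj U = 0 := by
    rw [Matrix.sub_mul, hU, Matrix.one_mul, sub_self]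
  have hVc : colProj V * (1 - colProj V) = 0 := by
    rw [Matrix.mul_sub, hV, Matrix.mul_one, sub_self]
  refine Submodule.eq_starProjection_of_mem_of_inner_eq_zero ⟨?_, ?_⟩ ?_
  · rw [← hW.mul_colProj_eq_iff, tangentFormula, Matrix.mul_assoc, hWW]
  · rw [hform, Matrix.mul_add, Matrix.add_mul, ← Matrix.mul_assoc (1 - colProj U) (colProj U * Z),
      ← Matrix.mul_assoc (1 - colProj U) (colProj U), hUc, Matrix.zero_mul, Matrix.zero_mul,
      Matrix.zero_mul, zero_add, Matrix.mul_assoc, Matrix.mul_assoc _ (colProj V), hVc,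
      Matrix.mul_zero, Matrix.mul_zero]
  · rintro ξ ⟨hξC, hξ⟩
    rw [← hW.mul_colProj_eq_iff] at hξC
    -- The reduced formula fixes tangent vectors; its factors are symmetric, so it moves across the
    -- inner product and leaves a residual orthogonal to `ξ`.
    have hξ' : ξ = colProj U * ξ * colProj W + (1 - colProj U) * ξ * colProj V := by
      rw [Matrix.mul_sub, Matrix.mul_one, sub_eq_zero] at hξ
      rw [← hξ, Matrix.mul_assoc, hξC, ← Matrix.add_mul, add_sub_cancel, Matrix.one_mul]
    have hcU : (1 - colProj U)ᵀ = 1 - colProj U := by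
      rw [Matrix.transpose_sub, Matrix.transpose_one, colProj_transpose]
    rw [hform, inner_sub_left, inner_add_left, inner_mul_mul_left, inner_mul_mul_left,
      ← inner_add_right, hcU]
    simp only [colProj_transpose]
    rw [← hξ', sub_self]

end SVD

theorem proposition2 {m n r k : ℕ} (C : Matrix (Fin n) (Fin n) ℝ) (X : Matrix (Fin m) (Fin n) ℝ)
    (hX : X ∈ selfExpressive m r C)
    (U : Matrix (Fin m) (Fin r) ℝ) (σ : Fin r → ℝ) (V : Matrix (Fin n) (Fin r) ℝ)
    (hsvd : IsCompactSVD X U σ V)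
    (W : Matrix (Fin n) (Fin k) ℝ) (hW : IsOrthonormalNullBasis (C - 1)ᵀ W) :
    ∃ T : Submodule ℝ (Matrix (Fin m) (Fin n) ℝ),
      (T : Set (Matrix (Fin m) (Fin n) ℝ)) = tangentVectors (selfExpressive m r C) X ∧
      -- the orthogonal projection onto the tangent space
      (∀ Z, T.starProjection Z = tangentFormula U V W Z) ∧
      -- the gradient, for `h` self-adjoint and idempotent
      (∀ h : Matrix (Fin m) (Fin n) ℝ →ₗ[ℝ] Matrix (Fin m) (Fin n) ℝ,
        h.IsSymmetric → IsIdempotentElem h →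
        ∀ G, IsRiemannianGradient (selfExpressive m r C) (objective h) X G ↔
          G = T.starProjection (h X)) ∧
      -- the gradient, for an arbitrary linear operator `h`
      (∀ h : Matrix (Fin m) (Fin n) ℝ →ₗ[ℝ] Matrix (Fin m) (Fin n) ℝ,
        ∀ G, IsRiemannianGradient (selfExpressive m r C) (objective h) X G ↔
          G = T.starProjection (LinearMap.adjoint h (h X))) ∧
      -- the Euclidean gradient is `h* h`, and equals `h` only for `h` self-adjoint and idempotent
      (∀ h : Matrix (Fin m) (Fin n) ℝ →ₗ[ℝ] Matrix (Fin m) (Fin n) ℝ,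
        (∀ Y, HasGradientAt (objective h) (LinearMap.adjoint h (h Y)) Y) ∧
        ((∀ Y, HasGradientAt (objective h) (h Y) Y) ↔ h.IsSymmetric ∧ IsIdempotentElem h)) ∧
      -- the sampling operators are self-adjoint and idempotent
      (∀ Ω : Set (Fin m × Fin n),
        (samplingOperator Ω).IsSymmetric ∧ IsIdempotentElem (samplingOperator Ω)) := by
  have hT := coe_selfExpressiveTangent hsvd hX.2
  have hgrad : ∀ (h : Matrix (Fin m) (Fin n) ℝ →ₗ[ℝ] Matrix (Fin m) (Fin n) ℝ) (Y),
      HasGradientAt (objective h) (LinearMap.adjoint h (h Y)) Y :=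
    hasGradientAt_half_norm_sq_comp
  refine ⟨selfExpressiveTangent C U V, hT, starProjection_selfExpressiveTangent hsvd hX.2 hW,
    fun h hs hi G => ?_, fun h G => ?_, fun h => ⟨hgrad h, ?_⟩,
    fun Ω => ⟨samplingOperator_isSymmetric Ω, samplingOperator_isIdempotentElem Ω⟩⟩
  · rw [isRiemannianGradient_iff_eq_starProjection hT (hgrad h X),
      (isSymmetric_and_isIdempotentElem_iff h).1 ⟨hs, hi⟩]
  · exact isRiemannianGradient_iff_eq_starProjection hT (hgrad h X) G
  · rw [isSymmetric_and_isIdempotentElem_iff]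
    exact forall_congr' fun Y => ⟨fun hY => (hgrad h Y).unique hY, fun hY => hY ▸ hgrad h Y⟩
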